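/- All sequences, arrays and polynomials are over $\mathbb{F}_2$. **Definitions.** An $r_1\times r_2$ array is doubly periodic (rows indexed modulo $r_1$, columns modulo $r_2$), so each of its $r_1r_2$ positions is the top left corner of an $n_1\times n_2$ window; the arrays of an array code are regarded up to cyclic vertical and horizontal shifts, and a code is given by a set of representatives. For positive integers $r_1,r_2,n_1,n_2$, an *$(r_1,r_2;n_1,n_2)$-PRAC* (pseudo-random array code) is a set $\mathcal{C}$ of $r_1\times r_2$ arrays such that $r_1r_2$ divides $2^{n_1n_2}-1$; every nonzero $n_1\times n_2$ matrix occurs exactly once as a window (in exactly one array of $\mathcal{C}$, at exactly one position), and the zero matrix does not occur; and, whenever $A,B\in\mathcal{C}$ and $B'$ is a shift of $B$, with $A\neq B$ or the shift nontrivial, $A+B'$ is a shift of an array of $\mathcal{C}$ (shift-and-add property). The *exponent* of a polynomial $h$ is the least $e\ge 1$ with $h(x)\mid x^e-1$; $h$ has *uniform exponent* $e$ if it is a non-constant product of distinct irreducible polynomials of exponent $e$. For polynomials $f_1,f_2$, $f_1\vee f_2=\prod_{\alpha,\beta}(x-\alpha\beta)$, where $\alpha,\beta$ run over the roots of $f_1$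 and of $f_2$ in an algebraic closure of $\mathbb{F}_2$. A polynomial $c(x)=\sum_{i=0}^{n}c_ix^i$ of degree $n$ with $c_0=1$ *generates* the sequences $(a_k)_{k\ge0}$ with $\sum_{i=0}^{n}c_ia_{k-i}=0$ for all $k\ge n$. For coprime $r_1,r_2$, the *folding* of a sequence $(a_k)$ of period $r_1r_2$ is the $r_1\times r_2$ array with the entry $a_k$ in row $k \bmod r_1$ and column $k\bmod r_2$, $0\le k<r_1r_2$. **Statement.** Let $n_1+1$ and $n_2+1$ be distinct odd primes. Then there exists an $(n_1+1,n_2+1;n_1,n_2)$-PRAC. More precisely, for $i=1,2$ the all-ones polynomial $f_i(x)=1+x+\dots+x^{n_i}$ has exponent $n_i+1$ and uniform exponent $n_i+1$; the polynomial $g=f_1\vee f_2$ has coefficients in $\mathbb{F}_2$ and every nonzero sequence generated by $g$ has least period $(n_1+1)(n_2+1)$; and there is an $(n_1+1,n_2+1;n_1,n_2)$-PRAC $\mathcal{C}$ such that every array of $\mathcal{C}$ is the folding of a nonzero sequence generated by $g$, and the folding of every nonzero sequence generated by $g$ is a shift of an array of $\mathcal{C}$. -/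

import Mathlib

open Polynomial

namespace PRAC

/-- A binary doubly-periodic `r₁ × r₂` array: rows are indexed modulo `r₁`, columns modulo `r₂`. -/
abbrev BinArray (r₁ r₂ : ℕ) : Type := Matrix (ZMod r₁) (ZMod r₂) (ZMod 2)

/-- The cyclic shift of an array, vertically by `s` and horizontally by `t`. -/
def shift {r₁ r₂ : ℕ} (A : BinArray r₁ r₂) (s : ZMod r₁) (t : ZMod r₂) : BinArray r₁ r₂ :=
  fun i j => A (i + s) (j + t)

/-- The `n₁ × n₂` window of a doubly-periodic array whose top left corner is at `(s, t)`. -/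
def window {r₁ r₂ : ℕ} (n₁ n₂ : ℕ) (A : BinArray r₁ r₂) (s : ZMod r₁) (t : ZMod r₂) :
    Matrix (Fin n₁) (Fin n₂) (ZMod 2) :=
  fun i j => A (s + ((i : ℕ) : ZMod r₁)) (t + ((j : ℕ) : ZMod r₂))

/-- `(r₁, r₂; n₁, n₂)` shortened de Bruijn array code.  The code is given by one representative
of each of its doubly-periodic arrays, which are regarded up to cyclic shifts. -/
structure IsSDBAC (r₁ r₂ n₁ n₂ : ℕ) (C : Set (BinArray r₁ r₂)) : Prop where
  r₁_pos : 0 < r₁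
  r₂_pos : 0 < r₂
  n₁_pos : 0 < n₁
  n₂_pos : 0 < n₂
  dvd : r₁ * r₂ ∣ 2 ^ (n₁ * n₂) - 1
  /-- The all-zero matrix is not a window of any codeword. -/
  window_ne_zero : ∀ A ∈ C, ∀ (s : ZMod r₁) (t : ZMod r₂), window n₁ n₂ A s t ≠ 0
  /-- Each nonzero matrix occurs exactly once: in one codeword, at one position. -/
  existsUnique_window : ∀ M : Matrix (Fin n₁) (Fin n₂) (ZMod 2), M ≠ 0 →
    ∃! x : BinArray r₁ r₂ × ZMod r₁ × ZMod r₂, x.1 ∈ C ∧ window n₁ n₂ x.1 x.2.1 x.2.2 = M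

/-- `(r₁, r₂; n₁, n₂)` pseudo-random array code: a shortened de Bruijn array code with the
shift-and-add property. -/
structure IsPRAC (r₁ r₂ n₁ n₂ : ℕ) (C : Set (BinArray r₁ r₂)) : Prop
    extends IsSDBAC r₁ r₂ n₁ n₂ C where
  shift_and_add : ∀ A ∈ C, ∀ B ∈ C, ∀ (s : ZMod r₁) (t : ZMod r₂),
    (A ≠ B ∨ s ≠ 0 ∨ t ≠ 0) → ∃ D ∈ C, ∃ (u : ZMod r₁) (v : ZMod r₂),
      A + shift B s t = shift D u v

/-- The exponent of a binary polynomial `h` is `e`: the least positive `e` with `h ∣ x ^ e - 1`. -/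
def HasExponent (h : (ZMod 2)[X]) (e : ℕ) : Prop :=
  IsLeast {m : ℕ | 0 < m ∧ h ∣ X ^ m - 1} e

/-- `f` has uniform exponent `e`: it is a non-constant product of distinct irreducible polynomials
of exponent `e`. -/
def HasUniformExponent (f : (ZMod 2)[X]) (e : ℕ) : Prop :=
  0 < f.natDegree ∧ Squarefree f ∧ ∀ q : (ZMod 2)[X], Irreducible q → q ∣ f → HasExponent q e

/-- The all-ones polynomial `1 + x + ⋯ + x ^ (p - 1)`. -/
noncomputable def allOnes (p : ℕ) : (ZMod 2)[X] := ∑ i ∈ Finset.range p, X ^ i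

/-- `g = f₁ ∨ f₂`: the polynomial `∏ (x - α β)`, over the roots `α` of `f₁` and `β` of `f₂` in an
algebraic closure of the binary field. -/
def IsVee (f₁ f₂ g : (ZMod 2)[X]) : Prop :=
  g.map (algebraMap (ZMod 2) (AlgebraicClosure (ZMod 2))) =
    (((f₁.aroots (AlgebraicClosure (ZMod 2))).product
      (f₂.aroots (AlgebraicClosure (ZMod 2)))).map fun z => X - C (z.1 * z.2)).prod

/-- The sequence `a` is generated by the characteristic polynomial `c = 1 - ∑ cᵢ xⁱ` of degree `n`:
`aₘ = ∑ cᵢ aₘ₋ᵢ` (sum over `1 ≤ i ≤ n`) for all `m ≥ n`, written with all terms on one side. -/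
def Generates (c : (ZMod 2)[X]) (a : ℕ → ZMod 2) : Prop :=
  ∀ m : ℕ, c.natDegree ≤ m → ∑ i ∈ Finset.range (c.natDegree + 1), c.coeff i * a (m - i) = 0

/-- `π` is the least period of the sequence `a`. -/
def HasLeastPeriod (a : ℕ → ZMod 2) (π : ℕ) : Prop :=
  IsLeast {m : ℕ | 0 < m ∧ ∀ k, a (k + m) = a k} π

/-- `B` is the folding into an `r₁ × r₂` array, `r₁` and `r₂` coprime, of the sequence
`a₀ a₁ ⋯` of length `r₁ r₂`: the entry `aₖ` is written in row `k mod r₁` and column `k mod r₂`. -/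
def IsFolding {r₁ r₂ : ℕ} (a : ℕ → ZMod 2) (B : BinArray r₁ r₂) : Prop :=
  r₁.Coprime r₂ ∧ ∀ k < r₁ * r₂, B (k : ZMod r₁) (k : ZMod r₂) = a k

end PRAC

/-!
The polynomial `g` is the cyclotomic polynomial `Φ_pq` modulo two, where `p = n₁ + 1` and
`q = n₂ + 1`: products of a primitive `p`-th and a primitive `q`-th root of unity run once through
the primitive `pq`-th roots of unity (`isVee_cyclotomic`).

The arrays obtained by folding the sequences generated by `g` are exactly the `p × q` arrays all of
whose row sums and column sums vanish (`generates_cyclotomic_iff`). Indeed, a generated sequence has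
period `pq`, hence is the diagonal reading of an array. A step of length `q` in the sequence stays
in one column of the array, so the column sums vanish if and only if `Φ_p(X ^ q) = Φ_pq Φ_p`
annihilates the sequence under the left shift; for the row sums it is `Φ_q(X ^ p) = Φ_pq Φ_q`. As
`Φ_p` and `Φ_q` are coprime, both annihilate it if and only if `Φ_pq` does. The recurrence generated
by `g` reads the coefficients backwards, which is harmless since `g` is a palindrome.

For zero-sum arrays the code properties are direct. A `(p - 1) × (q - 1)` window at any position can
be filled arbitrarily and determines the remaining row and column, so each window map is a bijection
(`exists_window_zero_eq`, `eq_zero_of_window_eq_zero`). A nonzero zero-sum array is not fixed by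
any nontrivial shift (`shift_eq_self_iff`): a fixed array would have all rows equal or all columns
equal, and as `p` and `q` are odd the vanishing sums then force all entries to vanish. Choosing one
array from each class of nonzero zero-sum arrays under shifts gives the code
(`isPRAC_zeroSumCode`), and the same triviality of stabilizers gives the least period
`pq` (`hasLeastPeriod_unfolding`).
-/

namespace PRAC

/-! ### Arrays with vanishing row and column sums -/

/-- The space of arrays in which every row and every column has sum zero. -/
def zeroSumArrays (r₁ r₂ : ℕ) [NeZero r₁] [NeZero r₂] : Submodule (ZMod 2) (BinArray r₁ r₂) where
  carrier := {A | (∀ j, ∑ i, A i j = 0) ∧ ∀ i, ∑ j, A i j = 0}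
  zero_mem' := by simp
  add_mem' := by
    rintro A B ⟨hA, hA'⟩ ⟨hB, hB'⟩
    simp [Finset.sum_add_distrib, hA, hA', hB, hB']
  smul_mem' := by
    rintro c A ⟨hA, hA'⟩
    simp [← Finset.mul_sum, hA, hA']

theorem sum_zmod_succ {M : Type*} [AddCommMonoid M] {n : ℕ} (f : ZMod (n + 1) → M)
    (s : ZMod (n + 1)) :
    ∑ i, f i = ∑ i : Fin n, f (s + ((i : ℕ) : ZMod (n + 1))) + f (s + (n : ZMod (n + 1))) := by
  rw [← Equiv.sum_comp (Equiv.addLeft s) f]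
  refine (Fin.sum_univ_castSucc (n := n) fun i => f (s + show ZMod (n + 1) from i)).trans ?_
  have hcast (i : ZMod (n + 1)) : ((i.val : ℕ) : ZMod (n + 1)) = i := ZMod.natCast_zmod_val i
  exact congrArg₂ (· + ·) (Finset.sum_congr rfl fun i _ => by rw [← hcast i.castSucc]; rfl)
    (by rw [← hcast (Fin.last n)]; rfl)

theorem eq_natCast_or_eq_natCast_last {n : ℕ} (s i : ZMod (n + 1)) :
    (∃ a : Fin n, i = s + ((a : ℕ) : ZMod (n + 1))) ∨ i = s + (n : ZMod (n + 1)) := by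
  have hlt := ZMod.val_lt (i - s)
  have hi : i = s + (((i - s).val : ℕ) : ZMod (n + 1)) := by
    rw [ZMod.natCast_zmod_val, add_sub_cancel]
  rcases Nat.lt_succ_iff_lt_or_eq.1 hlt with h | h
  · exact Or.inl ⟨⟨_, h⟩, hi⟩
  · exact Or.inr (by rw [h] at hi; exact hi)

/-- A function on `ZMod (n + 1)` with sum zero is determined by `n` consecutive values. -/
theorem eq_zero_of_sum_eq_zero {n : ℕ} {f : ZMod (n + 1) → ZMod 2} (hf : ∑ i, f i = 0)
    (s : ZMod (n + 1)) (h : ∀ a : Fin n, f (s + ((a : ℕ) : ZMod (n + 1))) = 0)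
    (i : ZMod (n + 1)) : f i = 0 := by
  rw [sum_zmod_succ f s, Finset.sum_eq_zero fun a _ => h a, zero_add] at hf
  rcases eq_natCast_or_eq_natCast_last s i with ⟨a, rfl⟩ | rfl
  exacts [h a, hf]

theorem eq_zero_of_window_eq_zero {n₁ n₂ : ℕ} {A : BinArray (n₁ + 1) (n₂ + 1)}
    (hA : A ∈ zeroSumArrays (n₁ + 1) (n₂ + 1)) {s : ZMod (n₁ + 1)} {t : ZMod (n₂ + 1)}
    (h : window n₁ n₂ A s t = 0) : A = 0 := by
  have hrow (a : Fin n₁) (j) : A (s + ((a : ℕ) : ZMod (n₁ + 1))) j = 0 :=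
    eq_zero_of_sum_eq_zero (hA.2 _) t (fun b => congrFun (congrFun h a) b) j
  ext i j
  exact eq_zero_of_sum_eq_zero (hA.1 j) s (fun a => hrow a j) i

theorem window_sub {r₁ r₂ n₁ n₂ : ℕ} (A B : BinArray r₁ r₂) (s : ZMod r₁) (t : ZMod r₂) :
    window n₁ n₂ (A - B) s t = window n₁ n₂ A s t - window n₁ n₂ B s t :=
  rfl

theorem window_shift {r₁ r₂ n₁ n₂ : ℕ} (A : BinArray r₁ r₂) (s u : ZMod r₁) (t v : ZMod r₂) :
    window n₁ n₂ (shift A s t) u v = window n₁ n₂ A (u + s) (v + t) := by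
  ext i j
  simp only [window, shift]
  congr 1 <;> ring

/-- The extension of `n` values to a function on `ZMod (n + 1)` with sum zero. -/
def extendZeroSum {n : ℕ} (w : Fin n → ZMod 2) (i : ZMod (n + 1)) : ZMod 2 :=
  if h : i.val < n then w ⟨i.val, h⟩ else -∑ a, w a

theorem extendZeroSum_natCast {n : ℕ} (w : Fin n → ZMod 2) (a : Fin n) :
    extendZeroSum w ((a : ℕ) : ZMod (n + 1)) = w a := by
  simp [extendZeroSum, ZMod.val_natCast_of_lt (a.2.trans n.lt_succ_self)]

theorem extendZeroSum_last {n : ℕ} (w : Fin n → ZMod 2) :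
    extendZeroSum w (n : ZMod (n + 1)) = -∑ a, w a := by
  simp only [extendZeroSum, ZMod.val_natCast_of_lt n.lt_succ_self, lt_irrefl, dite_false]

theorem sum_extendZeroSum {n : ℕ} (w : Fin n → ZMod 2) : ∑ i, extendZeroSum w i = 0 := by
  rw [sum_zmod_succ _ 0]
  simp only [zero_add, extendZeroSum_natCast, extendZeroSum_last, add_neg_cancel]

theorem exists_window_zero_eq {n₁ n₂ : ℕ} (M : Matrix (Fin n₁) (Fin n₂) (ZMod 2)) :
    ∃ A ∈ zeroSumArrays (n₁ + 1) (n₂ + 1), window n₁ n₂ A 0 0 = M := by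
  refine ⟨fun i j => extendZeroSum (fun a => extendZeroSum (M a) j) i,
    ⟨fun j => sum_extendZeroSum _, fun i => ?_⟩, ?_⟩
  -- Every row above the last has sum zero by construction; the last row is minus their sum.
  · rcases eq_natCast_or_eq_natCast_last 0 i with ⟨a, rfl⟩ | rfl
    · simp only [zero_add, extendZeroSum_natCast, sum_extendZeroSum]
    · simp only [zero_add, extendZeroSum_last, Finset.sum_neg_distrib]
      rw [Finset.sum_comm]
      simp [sum_extendZeroSum]
  · ext a b
    simp only [window, zero_add, extendZeroSum_natCast]

/-! ### Shifts of arrays -/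

theorem shift_zero {r₁ r₂ : ℕ} (A : BinArray r₁ r₂) : shift A 0 0 = A := by
  ext i j
  simp [shift]

theorem shift_shift {r₁ r₂ : ℕ} (A : BinArray r₁ r₂) (s u : ZMod r₁) (t v : ZMod r₂) :
    shift (shift A s t) u v = shift A (s + u) (t + v) := by
  ext i j
  simp only [shift, add_assoc, add_comm s, add_comm t]

theorem shift_mem {r₁ r₂ : ℕ} [NeZero r₁] [NeZero r₂] {A : BinArray r₁ r₂}
    (hA : A ∈ zeroSumArrays r₁ r₂) (s : ZMod r₁) (t : ZMod r₂) :
    shift A s t ∈ zeroSumArrays r₁ r₂ :=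
  ⟨fun j => (Equiv.sum_comp (Equiv.addRight s) fun i => A i (j + t)).trans (hA.1 _),
    fun i => (Equiv.sum_comp (Equiv.addRight t) fun j => A (i + s) j).trans (hA.2 _)⟩

theorem shift_nsmul_eq_self {r₁ r₂ : ℕ} {A : BinArray r₁ r₂} {s : ZMod r₁} {t : ZMod r₂}
    (h : shift A s t = A) (k : ℕ) : shift A (k * s) (k * t) = A := by
  induction k with
  | zero => simpa using shift_zero A
  | succ k ih =>
    have := shift_shift A (k * s) s (k * t) t
    rw [ih, h] at this
    rw [Nat.cast_succ, Nat.cast_succ, add_one_mul, add_one_mul, ← this]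

/-- A shift with nonzero vertical part, iterated `q` times, becomes a nontrivial vertical shift. If
it fixes the array, all rows are equal, so that each column sum is `p` times an entry. -/
theorem eq_zero_of_shift_eq_self {p q : ℕ} [Fact p.Prime] [Fact q.Prime] (hpq : p ≠ q)
    (hp : p ≠ 2) {A : BinArray p q} (hA : A ∈ zeroSumArrays p q) {s : ZMod p} {t : ZMod q}
    (h : shift A s t = A) (hs : s ≠ 0) : A = 0 := by
  have hq : (q : ZMod p) * s ≠ 0 := by
    refine mul_ne_zero (fun h0 => ?_) hs
    exact hpq ((Nat.prime_dvd_prime_iff_eq Fact.out Fact.out).1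
      ((ZMod.natCast_eq_zero_iff _ _).1 h0))
  have hv : shift A (q * s) 0 = A := by simpa using shift_nsmul_eq_self h q
  have hconst (i : ZMod p) (j : ZMod q) : A i j = A 0 j := by
    have := congrFun (congrFun (shift_nsmul_eq_self hv (i * (q * s)⁻¹).val) 0) j
    rw [ZMod.natCast_zmod_val, mul_assoc, inv_mul_cancel₀ hq, mul_one] at this
    simpa [shift] using this
  have hodd : (p : ZMod 2) = 1 :=
    ZMod.natCast_eq_one_iff_odd.2 ((Fact.out : p.Prime).odd_of_ne_two hp)
  ext i j
  have := hA.1 j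
  simp only [hconst _ j] at this
  rw [Finset.sum_const, Finset.card_univ, ZMod.card, nsmul_eq_mul, hodd, one_mul] at this
  rw [hconst i j, this]
  rfl

theorem shift_eq_self_iff {p q : ℕ} [Fact p.Prime] [Fact q.Prime] (hpq : p ≠ q)
    (hp : p ≠ 2) (hq : q ≠ 2) {A : BinArray p q} (hA : A ∈ zeroSumArrays p q) (h0 : A ≠ 0)
    {s : ZMod p} {t : ZMod q} : shift A s t = A ↔ s = 0 ∧ t = 0 := by
  refine ⟨fun h => ⟨by_contra fun hs => h0 (eq_zero_of_shift_eq_self hpq hp hA h hs),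
    by_contra fun ht => h0 ?_⟩, ?_⟩
  · have hT : shift A.transpose t s = A.transpose := congrArg Matrix.transpose h
    exact Matrix.transpose_eq_zero.1 (eq_zero_of_shift_eq_self hpq.symm hq ⟨hA.2, hA.1⟩ hT ht)
  · rintro ⟨rfl, rfl⟩
    exact shift_zero A

theorem shift_eq_zero_iff {r₁ r₂ : ℕ} {A : BinArray r₁ r₂} {s : ZMod r₁} {t : ZMod r₂} :
    shift A s t = 0 ↔ A = 0 := by
  constructor
  · intro h
    have := shift_shift A s (-s) t (-t)
    rw [h, add_neg_cancel, add_neg_cancel, shift_zero] at this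
    exact this.symm
  · rintro rfl
    rfl

/-- Arrays are equivalent when they are shifts of each other. -/
def shiftSetoid (r₁ r₂ : ℕ) : Setoid (BinArray r₁ r₂) where
  r A B := ∃ s t, B = shift A s t
  iseqv :=
    { refl := fun A => ⟨0, 0, (shift_zero A).symm⟩
      symm := by
        rintro A B ⟨s, t, rfl⟩
        exact ⟨-s, -t, by simp [shift_shift, shift_zero]⟩
      trans := by
        rintro A B D ⟨s, t, rfl⟩ ⟨u, v, rfl⟩
        exact ⟨s + u, t + v, shift_shift ..⟩ }

/-- The nonzero arrays with vanishing row and column sums, one from each class under shifts. -/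
def zeroSumCode (r₁ r₂ : ℕ) [NeZero r₁] [NeZero r₂] : Set (BinArray r₁ r₂) :=
  {A | A ∈ zeroSumArrays r₁ r₂ ∧ A ≠ 0 ∧ (Quotient.mk (shiftSetoid r₁ r₂) A).out = A}

theorem exists_mem_zeroSumCode {r₁ r₂ : ℕ} [NeZero r₁] [NeZero r₂] {A : BinArray r₁ r₂}
    (hA : A ∈ zeroSumArrays r₁ r₂) (h0 : A ≠ 0) :
    ∃ D ∈ zeroSumCode r₁ r₂, ∃ s t, A = shift D s t := by
  obtain ⟨s, t, hst⟩ := Quotient.mk_out (s := shiftSetoid r₁ r₂) A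
  obtain ⟨u, v, huv⟩ := (shiftSetoid r₁ r₂).symm (Quotient.mk_out (s := shiftSetoid r₁ r₂) A)
  refine ⟨_, ⟨?_, ?_, ?_⟩, s, t, hst⟩
  · rw [huv]
    exact shift_mem hA u v
  · rw [huv, Ne, shift_eq_zero_iff]
    exact h0
  · rw [Quotient.out_eq]

theorem eq_of_mem_zeroSumCode {r₁ r₂ : ℕ} [NeZero r₁] [NeZero r₂] {A B : BinArray r₁ r₂}
    (hA : A ∈ zeroSumCode r₁ r₂) (hB : B ∈ zeroSumCode r₁ r₂) {s u : ZMod r₁} {t v : ZMod r₂}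
    (h : shift A s t = shift B u v) : A = B := by
  rw [← hA.2.2, ← hB.2.2]
  congr 1
  refine Quotient.sound ((shiftSetoid r₁ r₂).trans ⟨s, t, rfl⟩ ?_)
  exact (shiftSetoid r₁ r₂).symm ⟨u, v, h⟩

/-- The window map is a bijection from the zero-sum arrays at each position, and the shifts of a
nonzero zero-sum array are distinct; together these give the code properties. -/
theorem isPRAC_zeroSumCode {n₁ n₂ : ℕ} [Fact (n₁ + 1).Prime] [Fact (n₂ + 1).Prime]
    (hne : n₁ + 1 ≠ n₂ + 1) (h₁ : n₁ + 1 ≠ 2) (h₂ : n₂ + 1 ≠ 2) :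
    IsPRAC (n₁ + 1) (n₂ + 1) n₁ n₂ (zeroSumCode (n₁ + 1) (n₂ + 1)) where
  r₁_pos := n₁.succ_pos
  r₂_pos := n₂.succ_pos
  n₁_pos := Nat.succ_lt_succ_iff.1 (Fact.out : (n₁ + 1).Prime).one_lt
  n₂_pos := Nat.succ_lt_succ_iff.1 (Fact.out : (n₂ + 1).Prime).one_lt
  dvd := by
    have fermat (n m : ℕ) [hn : Fact (n + 1).Prime] (h2 : n + 1 ≠ 2) :
        n + 1 ∣ 2 ^ (n * m) - 1 := by
      refine (Nat.modEq_iff_dvd' Nat.one_le_two_pow).1 ?_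
      have hc : Nat.Coprime 2 (n + 1) :=
        (Nat.coprime_primes Nat.prime_two hn.out).2 h2.symm
      have := (Nat.ModEq.pow_totient hc).pow m
      rw [Nat.totient_prime hn.out, one_pow, ← pow_mul, Nat.add_sub_cancel] at this
      exact this.symm
    -- `n₁ + 1` and `n₂ + 1` are coprime, and each divides by Fermat's little theorem.
    refine Nat.Coprime.mul_dvd_of_dvd_of_dvd ((Nat.coprime_primes Fact.out Fact.out).2 hne)
      (fermat n₁ n₂ h₁) ?_
    rw [mul_comm]
    exact fermat n₂ n₁ h₂
  window_ne_zero A hA s t h := hA.2.1 (eq_zero_of_window_eq_zero hA.1 h)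
  existsUnique_window M hM := by
    obtain ⟨A, hA, rfl⟩ := exists_window_zero_eq M
    have hA0 : A ≠ 0 := by
      rintro rfl
      exact hM rfl
    obtain ⟨D, hD, s, t, rfl⟩ := exists_mem_zeroSumCode hA hA0
    refine ⟨(D, s, t), ⟨hD, by simp [window_shift]⟩, ?_⟩
    rintro ⟨B, u, v⟩ ⟨hB, hw⟩
    have hBD : shift B u v = shift D s t := by
      rw [← sub_eq_zero]
      refine eq_zero_of_window_eq_zero (s := 0) (t := 0)
        (sub_mem (shift_mem hB.1 u v) hA) ?_
      rw [window_sub, ← hw, window_shift, zero_add, zero_add, sub_self]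
    obtain rfl : B = D := eq_of_mem_zeroSumCode hB hD hBD
    have hself : shift B (u - s) (v - t) = B := by
      have := congrArg (fun A => shift A (-s) (-t)) hBD
      simpa [shift_shift, shift_zero, sub_eq_add_neg] using this
    obtain ⟨hu, hv⟩ := (shift_eq_self_iff hne h₁ h₂ hB.1 hB.2.1).1 hself
    rw [sub_eq_zero.1 hu, sub_eq_zero.1 hv]
  shift_and_add A hA B hB s t hor := by
    refine exists_mem_zeroSumCode (add_mem hA.1 (shift_mem hB.1 s t)) fun h0 => ?_
    have hAB : shift A 0 0 = shift B s t := by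
      rw [shift_zero]
      ext i j
      have := congrFun (congrFun h0 i) j
      exact CharTwo.add_eq_zero.1 this
    obtain rfl : A = B := eq_of_mem_zeroSumCode hA hB hAB
    rw [shift_zero] at hAB
    obtain ⟨hs, ht⟩ := (shift_eq_self_iff hne h₁ h₂ hA.1 hA.2.1).1 hAB.symm
    simp [hs, ht] at hor

/-! ### Roots of unity and cyclotomic polynomials modulo two -/

theorem allOnes_eq_cyclotomic (p : ℕ) [Fact p.Prime] : allOnes p = cyclotomic p (ZMod 2) :=
  (cyclotomic_prime (ZMod 2) p).symm

theorem neZero_natCast_of_odd {K : Type*} [Field K] [CharP K 2] {n : ℕ} (hn : Odd n) :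
    NeZero (n : K) :=
  ⟨fun h => by
    have := (CharP.cast_eq_zero_iff K 2 n).1 h
    exact Nat.not_even_iff_odd.2 hn (even_iff_two_dvd.2 this)⟩

theorem odd_of_prime_ne_two {p : ℕ} [hp : Fact p.Prime] (h : p ≠ 2) : Odd p :=
  hp.out.odd_of_ne_two h

theorem isPrimitiveRoot_of_aeval_cyclotomic_eq_zero {n : ℕ} (hn : Odd n)
    {x : AlgebraicClosure (ZMod 2)} (h : aeval x (cyclotomic n (ZMod 2)) = 0) :
    IsPrimitiveRoot x n := by
  have : CharP (AlgebraicClosure (ZMod 2)) 2 := charP_of_injective_algebraMap' (ZMod 2) 2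
  have := neZero_natCast_of_odd (K := AlgebraicClosure (ZMod 2)) hn
  rwa [aeval_def, ← eval_map, map_cyclotomic, ← IsRoot.def, isRoot_cyclotomic_iff] at h

theorem isCoprime_cyclotomic {m n : ℕ} (hm : Odd m) (hn : Odd n) (h : m ≠ n) :
    IsCoprime (cyclotomic m (ZMod 2)) (cyclotomic n (ZMod 2)) := by
  refine (isCoprime_iff_aeval_ne_zero_of_isAlgClosed (ZMod 2) (AlgebraicClosure (ZMod 2)) _ _).2
    fun x => ?_
  by_contra! hx
  exact h ((isPrimitiveRoot_of_aeval_cyclotomic_eq_zero hm hx.1).unique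
    (isPrimitiveRoot_of_aeval_cyclotomic_eq_zero hn hx.2))

/-- A nonconstant factor of the all-ones polynomial has a primitive `p`-th root of unity as a
root, whence it divides `X ^ m - 1` only for multiples `m` of `p`. -/
theorem hasExponent_of_dvd_allOnes {p : ℕ} [hp : Fact p.Prime] (h2 : p ≠ 2) {q : (ZMod 2)[X]}
    (hq : q.degree ≠ 0) (hdvd : q ∣ allOnes p) : HasExponent q p := by
  rw [allOnes_eq_cyclotomic] at hdvd
  refine ⟨⟨hp.out.pos, hdvd.trans (cyclotomic.dvd_X_pow_sub_one p _)⟩, ?_⟩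
  rintro m ⟨hm, hqm⟩
  obtain ⟨x, hx⟩ := IsAlgClosed.exists_aeval_eq_zero (AlgebraicClosure (ZMod 2)) q hq
  have hprim := isPrimitiveRoot_of_aeval_cyclotomic_eq_zero (odd_of_prime_ne_two h2)
    (aeval_eq_zero_of_dvd_aeval_eq_zero hdvd hx)
  have hxm := aeval_eq_zero_of_dvd_aeval_eq_zero hqm hx
  rw [map_sub, map_pow, aeval_X, map_one, sub_eq_zero] at hxm
  exact Nat.le_of_dvd hm (hprim.dvd_of_pow_eq_one m hxm)

theorem natDegree_allOnes_pos (p : ℕ) [hp : Fact p.Prime] : 0 < (allOnes p).natDegree := by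
  rw [allOnes_eq_cyclotomic, natDegree_cyclotomic]
  exact Nat.totient_pos.2 hp.out.pos

theorem hasExponent_allOnes {p : ℕ} [Fact p.Prime] (h2 : p ≠ 2) : HasExponent (allOnes p) p :=
  hasExponent_of_dvd_allOnes h2 (natDegree_pos_iff_degree_pos.1 (natDegree_allOnes_pos p)).ne'
    dvd_rfl

theorem hasUniformExponent_allOnes {p : ℕ} [Fact p.Prime] (h2 : p ≠ 2) :
    HasUniformExponent (allOnes p) p := by
  refine ⟨natDegree_allOnes_pos p, ?_, fun q hq hdvd =>
    hasExponent_of_dvd_allOnes h2 (degree_pos_of_irreducible hq).ne' hdvd⟩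
  have := neZero_natCast_of_odd (K := ZMod 2) (odd_of_prime_ne_two (p := p) h2)
  rw [allOnes_eq_cyclotomic]
  exact squarefree_cyclotomic p (ZMod 2)

open Classical in
/-- For coprime orders, multiplication of primitive roots of unity is injective, and it is onto by
the multiplicativity of the totient. -/
theorem image_mul_primitiveRoots {K : Type*} [Field K] {m n : ℕ} (h : m.Coprime n) (hm : 0 < m)
    (hn : 0 < n) {ζ ξ : K} (hζ : IsPrimitiveRoot ζ m) (hξ : IsPrimitiveRoot ξ n) :
    Set.InjOn (fun z : K × K => z.1 * z.2) (primitiveRoots m K ×ˢ primitiveRoots n K : Finset _) ∧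
      (primitiveRoots m K ×ˢ primitiveRoots n K).image (fun z => z.1 * z.2) =
        primitiveRoots (m * n) K := by
  have hmul {x y : K} (hx : IsPrimitiveRoot x m) (hy : IsPrimitiveRoot y n) :
      IsPrimitiveRoot (x * y) (m * n) := by
    rw [IsPrimitiveRoot.iff_orderOf, (Commute.all x y).orderOf_mul_eq_mul_orderOf_of_coprime] <;>
      rw [← hx.eq_orderOf, ← hy.eq_orderOf]
    exact h
  have hinj : Set.InjOn (fun z : K × K => z.1 * z.2)
      (primitiveRoots m K ×ˢ primitiveRoots n K : Finset _) := by
    rintro ⟨x, y⟩ hz ⟨x', y'⟩ hz' (hxy : x * y = x' * y')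
    rw [Finset.mem_coe, Finset.mem_product, mem_primitiveRoots hm, mem_primitiveRoots hn] at hz hz'
    have hx0 : x' ≠ 0 := hz'.1.ne_zero hm.ne'
    have hy0 : y ≠ 0 := hz.2.ne_zero hn.ne'
    -- The ratio of the first factors is an `m`-th and an `n`-th root of unity.
    have hratio : x / x' = y' / y := by
      rw [div_eq_div_iff hx0 hy0, hxy, mul_comm]
    have h1 : (x / x') ^ m = 1 := by rw [div_pow, hz.1.pow_eq_one, hz'.1.pow_eq_one, div_one]
    have h2 : (x / x') ^ n = 1 := by
      rw [hratio, div_pow, hz.2.pow_eq_one, hz'.2.pow_eq_one, div_one]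
    have h3 : x / x' = 1 := by
      rw [← orderOf_eq_one_iff, ← Nat.dvd_one, ← Nat.Coprime.gcd_eq_one h]
      exact Nat.dvd_gcd (orderOf_dvd_of_pow_eq_one h1) (orderOf_dvd_of_pow_eq_one h2)
    obtain rfl : x = x' := (div_eq_one_iff_eq hx0).1 h3
    rw [mul_right_inj' hx0] at hxy
    rw [hxy]
  refine ⟨hinj, Finset.eq_of_subset_of_card_le ?_ ?_⟩
  · intro w hw
    obtain ⟨⟨x, y⟩, hz, rfl⟩ := Finset.mem_image.1 hw
    rw [Finset.mem_product, mem_primitiveRoots hm, mem_primitiveRoots hn] at hz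
    exact (mem_primitiveRoots (Nat.mul_pos hm hn)).2 (hmul hz.1 hz.2)
  · rw [Finset.card_image_of_injOn hinj, Finset.card_product, hζ.card_primitiveRoots,
      hξ.card_primitiveRoots, (hmul hζ hξ).card_primitiveRoots, Nat.totient_mul h]

theorem isVee_cyclotomic {p q : ℕ} [hp : Fact p.Prime] [hq : Fact q.Prime] (hpq : p ≠ q)
    (hp2 : p ≠ 2) (hq2 : q ≠ 2) :
    IsVee (allOnes p) (allOnes q) (cyclotomic (p * q) (ZMod 2)) := by
  classical
  have : CharP (AlgebraicClosure (ZMod 2)) 2 := charP_of_injective_algebraMap' (ZMod 2) 2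
  have hnp := neZero_natCast_of_odd (K := AlgebraicClosure (ZMod 2)) (odd_of_prime_ne_two hp2)
  have hnq := neZero_natCast_of_odd (K := AlgebraicClosure (ZMod 2)) (odd_of_prime_ne_two hq2)
  have hnpq := neZero_natCast_of_odd (K := AlgebraicClosure (ZMod 2))
    ((odd_of_prime_ne_two hp2).mul (odd_of_prime_ne_two hq2))
  obtain ⟨ζ, hζ⟩ := HasEnoughRootsOfUnity.exists_primitiveRoot (AlgebraicClosure (ZMod 2)) p
  obtain ⟨ξ, hξ⟩ := HasEnoughRootsOfUnity.exists_primitiveRoot (AlgebraicClosure (ZMod 2)) q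
  obtain ⟨ω, hω⟩ := HasEnoughRootsOfUnity.exists_primitiveRoot (AlgebraicClosure (ZMod 2)) (p * q)
  obtain ⟨hinj, himage⟩ := image_mul_primitiveRoots
    ((Nat.coprime_primes hp.out hq.out).2 hpq) hp.out.pos hq.out.pos hζ hξ
  rw [IsVee, map_cyclotomic, cyclotomic_eq_prod_X_sub_primitiveRoots hω, ← himage,
    Finset.prod_image hinj, aroots, aroots, allOnes_eq_cyclotomic, allOnes_eq_cyclotomic,
    map_cyclotomic, map_cyclotomic, cyclotomic.roots_eq_primitiveRoots_val,
    cyclotomic.roots_eq_primitiveRoots_val]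
  rfl

/-! ### Palindromic polynomials -/

theorem reverse_X_pow_sub_one (m : ℕ) :
    (X ^ m - 1 : (ZMod 2)[X]).reverse = X ^ m - 1 := by
  have hX : (X ^ m : (ZMod 2)[X]).reflect m = 1 := by
    rw [reflect_monomial, revAt_le le_rfl, Nat.sub_self, pow_zero]
  have hdeg : (X ^ m - 1 : (ZMod 2)[X]).natDegree = m := natDegree_X_pow_sub_C (r := 1)
  rw [reverse, hdeg, reflect_sub, hX, reflect_one, CharTwo.sub_eq_add, CharTwo.sub_eq_add, add_comm]

theorem reverse_eq_of_mul {f h : (ZMod 2)[X]} (h0 : h ≠ 0) (hh : h.reverse = h)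
    (hfh : (f * h).reverse = f * h) : f.reverse = f := by
  rw [reverse_mul_of_domain, hh] at hfh
  exact mul_right_cancel₀ h0 hfh

theorem expand_cyclotomic_mul_X_pow_sub_one (p q : ℕ) [Fact p.Prime] :
    expand (ZMod 2) q (cyclotomic p (ZMod 2)) * (X ^ q - 1) = X ^ (p * q) - 1 := by
  have := congrArg (expand (ZMod 2) q) (cyclotomic_prime_mul_X_sub_one (ZMod 2) p)
  simpa [← pow_mul, mul_comm q p] using this

theorem expand_cyclotomic_eq {p q : ℕ} [hp : Fact p.Prime] [hq : Fact q.Prime] (hpq : p ≠ q) :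
    expand (ZMod 2) q (cyclotomic p (ZMod 2)) =
      cyclotomic (p * q) (ZMod 2) * cyclotomic p (ZMod 2) :=
  cyclotomic_expand_eq_cyclotomic_mul hq.out
    (fun h => hpq ((Nat.prime_dvd_prime_iff_eq hq.out hp.out).1 h).symm) _

/-- Both `Φ_p` and `Φ_p(X ^ q) = Φ_pq Φ_p` are quotients of palindromes `X ^ m - 1`, and so
palindromes. -/
theorem reverse_cyclotomic_mul {p q : ℕ} [hp : Fact p.Prime] [hq : Fact q.Prime] (hpq : p ≠ q) :
    (cyclotomic (p * q) (ZMod 2)).reverse = cyclotomic (p * q) (ZMod 2) := by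
  have hexpand {r : ℕ} (hr : 0 < r) : (expand (ZMod 2) r (cyclotomic p (ZMod 2))).reverse =
      expand (ZMod 2) r (cyclotomic p (ZMod 2)) := by
    refine reverse_eq_of_mul (X_pow_sub_C_ne_zero hr 1) (reverse_X_pow_sub_one r) ?_
    rw [C_1, expand_cyclotomic_mul_X_pow_sub_one, reverse_X_pow_sub_one]
  refine reverse_eq_of_mul (cyclotomic_ne_zero p _) ?_ ?_
  · simpa using hexpand one_pos
  · rw [← expand_cyclotomic_eq hpq, hexpand hq.out.pos]

/-! ### Linear recurring sequences -/

/-- The left shift of binary sequences, `a ↦ (a₁, a₂, …)`. -/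
def seqShift : Module.End (ZMod 2) (ℕ → ZMod 2) :=
  LinearMap.funLeft (ZMod 2) (ZMod 2) Nat.succ

theorem seqShift_pow_apply (m : ℕ) (a : ℕ → ZMod 2) (k : ℕ) : (seqShift ^ m) a k = a (k + m) := by
  induction m generalizing a with
  | zero => rfl
  | succ m ih =>
    rw [pow_succ, Module.End.mul_apply, ih]
    rfl

theorem aeval_seqShift_apply (f : (ZMod 2)[X]) (a : ℕ → ZMod 2) (k : ℕ) :
    aeval seqShift f a k = ∑ i ∈ Finset.range (f.natDegree + 1), f.coeff i * a (k + i) := by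
  rw [aeval_eq_sum_range, LinearMap.sum_apply, Finset.sum_apply]
  simp [seqShift_pow_apply]

theorem aeval_seqShift_X_pow_sub_one_eq_zero_iff {m : ℕ} {a : ℕ → ZMod 2} :
    aeval seqShift (X ^ m - 1 : (ZMod 2)[X]) a = 0 ↔ ∀ k, a (k + m) = a k := by
  rw [funext_iff]
  refine forall_congr' fun k => ?_
  rw [map_sub, map_pow, aeval_X, map_one, LinearMap.sub_apply, Pi.sub_apply, seqShift_pow_apply,
    Module.End.one_apply, Pi.zero_apply, sub_eq_zero]

/-- The recurrence generated by `c` has characteristic polynomial `c.reverse`; the two agree for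
palindromic `c`. -/
theorem generates_iff_aeval_eq_zero {c : (ZMod 2)[X]} (hc : c.reverse = c) {a : ℕ → ZMod 2} :
    Generates c a ↔ aeval seqShift c a = 0 := by
  have key (k : ℕ) : ∑ i ∈ Finset.range (c.natDegree + 1), c.coeff i * a (k + c.natDegree - i) =
      aeval seqShift c a k := by
    rw [aeval_seqShift_apply, ← Finset.sum_range_reflect]
    refine Finset.sum_congr rfl fun i hi => ?_
    have hi : i ≤ c.natDegree := Nat.lt_succ_iff.1 (Finset.mem_range.1 hi)
    have hcoeff : c.coeff (c.natDegree - i) = c.coeff i := by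
      conv_rhs => rw [← hc, coeff_reverse, revAt_le hi]
    rw [show c.natDegree + 1 - 1 - i = c.natDegree - i by omega, hcoeff,
      show k + c.natDegree - (c.natDegree - i) = k + i by omega]
  constructor
  · intro h
    ext k
    rw [← key, h _ (Nat.le_add_left ..)]
    rfl
  · intro h m hm
    obtain ⟨k, rfl⟩ := Nat.exists_eq_add_of_le' hm
    rw [key, h]
    rfl

/-! ### Foldings of sequences -/

/-- The sequence read along the diagonal of a doubly periodic array. -/
def unfolding {r₁ r₂ : ℕ} (A : BinArray r₁ r₂) (k : ℕ) : ZMod 2 :=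
  A (k : ZMod r₁) (k : ZMod r₂)

theorem exists_natCast_eq {p q : ℕ} [NeZero p] [NeZero q] (h : p.Coprime q) (i : ZMod p)
    (j : ZMod q) : ∃ k : ℕ, (k : ZMod p) = i ∧ (k : ZMod q) = j := by
  obtain ⟨k, hk₁, hk₂⟩ := Nat.chineseRemainder h i.val j.val
  refine ⟨k, ?_, ?_⟩
  · rw [(ZMod.natCast_eq_natCast_iff _ _ _).2 hk₁, ZMod.natCast_zmod_val]
  · rw [(ZMod.natCast_eq_natCast_iff _ _ _).2 hk₂, ZMod.natCast_zmod_val]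

theorem unfolding_injective {p q : ℕ} [NeZero p] [NeZero q] (h : p.Coprime q) :
    Function.Injective (unfolding : BinArray p q → ℕ → ZMod 2) := by
  intro A B hAB
  ext i j
  obtain ⟨k, rfl, rfl⟩ := exists_natCast_eq h i j
  exact congrFun hAB k

theorem unfolding_shift {r₁ r₂ : ℕ} (A : BinArray r₁ r₂) (m k : ℕ) :
    unfolding (shift A m m) k = unfolding A (k + m) := by
  simp [unfolding, shift]

theorem isFolding_unfolding {p q : ℕ} (h : p.Coprime q) (A : BinArray p q) :
    IsFolding (unfolding A) A :=
  ⟨h, fun _ _ => rfl⟩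

theorem unfolding_add_mul {p q : ℕ} (A : BinArray p q) (k : ℕ) :
    unfolding A (k + p * q) = unfolding A k := by
  simp [unfolding]

theorem exists_eq_unfolding {p q : ℕ} [NeZero p] [NeZero q] (h : p.Coprime q) {a : ℕ → ZMod 2}
    (ha : ∀ k, a (k + p * q) = a k) : ∃ A : BinArray p q, a = unfolding A := by
  refine ⟨fun i j => a (Nat.chineseRemainder h i.val j.val), funext fun k => ?_⟩
  have hper : Function.Periodic a (p * q) := ha
  have hk : (Nat.chineseRemainder h (k : ZMod p).val (k : ZMod q).val : ℕ) ≡ k [MOD p * q] := by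
    refine (Nat.modEq_and_modEq_iff_modEq_mul h).1 ⟨?_, ?_⟩
    · refine (Nat.chineseRemainder h _ _).2.1.trans ?_
      rw [ZMod.val_natCast]
      exact Nat.mod_modEq k p
    · refine (Nat.chineseRemainder h _ _).2.2.trans ?_
      rw [ZMod.val_natCast]
      exact Nat.mod_modEq k q
  exact ((hper.map_mod_nat _).symm.trans (congrArg a hk.symm)).trans (hper.map_mod_nat _)

theorem aeval_expand_cyclotomic_apply (p q : ℕ) [Fact p.Prime] (a : ℕ → ZMod 2) (k : ℕ) :
    aeval seqShift (expand (ZMod 2) q (cyclotomic p (ZMod 2))) a k =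
      ∑ l ∈ Finset.range p, a (k + q * l) := by
  rw [cyclotomic_prime, map_sum, map_sum, LinearMap.sum_apply, Finset.sum_apply]
  refine Finset.sum_congr rfl fun l _ => ?_
  rw [map_pow, expand_X, ← pow_mul, map_pow, aeval_X, seqShift_pow_apply]

theorem sum_range_affine {p : ℕ} [Fact p.Prime] (f : ZMod p → ZMod 2) (c : ZMod p) {u : ZMod p}
    (hu : u ≠ 0) : ∑ l ∈ Finset.range p, f (c + u * (l : ZMod p)) = ∑ i, f i := by
  refine Finset.sum_nbij' (fun l => c + u * (l : ZMod p)) (fun i => ((i - c) / u).val)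
    (by simp) (fun i _ => Finset.mem_range.2 (ZMod.val_lt _)) (fun l hl => ?_) (fun i _ => ?_)
    (fun _ _ => rfl)
  · rw [add_sub_cancel_left, mul_div_cancel_left₀ _ hu,
      ZMod.val_natCast_of_lt (Finset.mem_range.1 hl)]
  · rw [ZMod.natCast_zmod_val, mul_div_cancel₀ _ hu, add_sub_cancel]

/-- Steps of length `q` in the unfolding stay in one column. -/
theorem aeval_expand_unfolding_apply {p q : ℕ} [hp : Fact p.Prime] [hq : Fact q.Prime]
    (hpq : p ≠ q) (A : BinArray p q) (k : ℕ) :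
    aeval seqShift (expand (ZMod 2) q (cyclotomic p (ZMod 2))) (unfolding A) k = ∑ i, A i k := by
  have hu : (q : ZMod p) ≠ 0 := fun h =>
    hpq ((Nat.prime_dvd_prime_iff_eq hp.out hq.out).1 ((ZMod.natCast_eq_zero_iff _ _).1 h))
  rw [aeval_expand_cyclotomic_apply, ← sum_range_affine (fun i => A i k) (k : ZMod p) hu]
  refine Finset.sum_congr rfl fun l _ => ?_
  simp [unfolding]

theorem unfolding_transpose {r₁ r₂ : ℕ} (A : BinArray r₁ r₂) :
    unfolding A.transpose = unfolding A :=
  rfl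

theorem aeval_expand_unfolding_eq_zero_iff {p q : ℕ} [Fact p.Prime] [Fact q.Prime]
    (hpq : p ≠ q) (A : BinArray p q) :
    aeval seqShift (expand (ZMod 2) q (cyclotomic p (ZMod 2))) (unfolding A) = 0 ↔
      ∀ j, ∑ i, A i j = 0 := by
  constructor
  · intro h j
    rw [← ZMod.natCast_zmod_val j, ← aeval_expand_unfolding_apply hpq, h]
    rfl
  · intro h
    ext k
    rw [aeval_expand_unfolding_apply hpq, h]
    rfl

/-- With `Φ` standing for cyclotomic polynomials, `Φ_p(X ^ q) = Φ_pq Φ_p` and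
`Φ_q(X ^ p) = Φ_pq Φ_q` annihilate the unfolding of an array exactly when its column sums,
respectively row sums, vanish; and their greatest common divisor is `Φ_pq`. -/
theorem generates_cyclotomic_iff {p q : ℕ} [hp : Fact p.Prime] [hq : Fact q.Prime] (hpq : p ≠ q)
    (hp2 : p ≠ 2) (hq2 : q ≠ 2) {a : ℕ → ZMod 2} :
    Generates (cyclotomic (p * q) (ZMod 2)) a ↔ ∃ A ∈ zeroSumArrays p q, a = unfolding A := by
  have hco : p.Coprime q := (Nat.coprime_primes hp.out hq.out).2 hpq
  have hrow (A : BinArray p q) := aeval_expand_unfolding_eq_zero_iff hpq.symm A.transpose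
  have hcol (A : BinArray p q) := aeval_expand_unfolding_eq_zero_iff hpq A
  simp only [unfolding_transpose, expand_cyclotomic_eq hpq.symm, Matrix.transpose_apply,
    mul_comm q p] at hrow
  simp only [expand_cyclotomic_eq hpq] at hcol
  rw [generates_iff_aeval_eq_zero (reverse_cyclotomic_mul hpq)]
  constructor
  · intro h
    have hmul (f : (ZMod 2)[X]) : aeval seqShift (cyclotomic (p * q) (ZMod 2) * f) a = 0 := by
      rw [mul_comm, map_mul, Module.End.mul_apply, h, map_zero]
    obtain ⟨f, hf⟩ := cyclotomic.dvd_X_pow_sub_one (p * q) (ZMod 2)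
    obtain ⟨A, rfl⟩ := exists_eq_unfolding hco
      (aeval_seqShift_X_pow_sub_one_eq_zero_iff.1 (hf ▸ hmul f))
    exact ⟨A, ⟨(hcol A).1 (hmul _), (hrow A).1 (hmul _)⟩, rfl⟩
  · rintro ⟨A, hA, rfl⟩
    obtain ⟨u, v, huv⟩ := isCoprime_cyclotomic (odd_of_prime_ne_two hp2) (odd_of_prime_ne_two hq2)
      hpq
    have hbezout : cyclotomic (p * q) (ZMod 2) =
        u * (cyclotomic (p * q) (ZMod 2) * cyclotomic p (ZMod 2)) +
          v * (cyclotomic (p * q) (ZMod 2) * cyclotomic q (ZMod 2)) := by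
      linear_combination -cyclotomic (p * q) (ZMod 2) * huv
    rw [hbezout, map_add, map_mul, map_mul _ v, LinearMap.add_apply, Module.End.mul_apply,
      Module.End.mul_apply, (hcol A).2 hA.1, (hrow A).2 hA.2, map_zero, map_zero, add_zero]

theorem hasLeastPeriod_unfolding {p q : ℕ} [hp : Fact p.Prime] [hq : Fact q.Prime] (hpq : p ≠ q)
    (hp2 : p ≠ 2) (hq2 : q ≠ 2) {A : BinArray p q} (hA : A ∈ zeroSumArrays p q) (h0 : A ≠ 0) :
    HasLeastPeriod (unfolding A) (p * q) := by
  have hco : p.Coprime q := (Nat.coprime_primes hp.out hq.out).2 hpq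
  refine ⟨⟨Nat.mul_pos hp.out.pos hq.out.pos, unfolding_add_mul A⟩, ?_⟩
  rintro m ⟨hm, hper⟩
  have hshift : shift A m m = A :=
    unfolding_injective hco (funext fun k => (unfolding_shift A m k).trans (hper k))
  obtain ⟨h₁, h₂⟩ := (shift_eq_self_iff hpq hp2 hq2 hA h0).1 hshift
  exact Nat.le_of_dvd hm (hco.mul_dvd_of_dvd_of_dvd ((ZMod.natCast_eq_zero_iff _ _).1 h₁)
    ((ZMod.natCast_eq_zero_iff _ _).1 h₂))

end PRAC

/-! ### The code of foldings -/

theorem mainTheorem10 (n₁ n₂ : ℕ) (hp₁ : (n₁ + 1).Prime) (hp₂ : (n₂ + 1).Prime)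
    (hne : n₁ + 1 ≠ n₂ + 1) (hodd₁ : n₁ + 1 ≠ 2) (hodd₂ : n₂ + 1 ≠ 2) :
    -- the all-ones polynomials have exponents `n₁ + 1` and `n₂ + 1`
    (PRAC.HasExponent (PRAC.allOnes (n₁ + 1)) (n₁ + 1) ∧
      PRAC.HasUniformExponent (PRAC.allOnes (n₁ + 1)) (n₁ + 1)) ∧
    (PRAC.HasExponent (PRAC.allOnes (n₂ + 1)) (n₂ + 1) ∧
      PRAC.HasUniformExponent (PRAC.allOnes (n₂ + 1)) (n₂ + 1)) ∧
    -- and folding the sequences generated by `g = f₁ ∨ f₂` gives a pseudo-random array code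
    ∃ g : Polynomial (ZMod 2),
      PRAC.IsVee (PRAC.allOnes (n₁ + 1)) (PRAC.allOnes (n₂ + 1)) g ∧
      (∀ a : ℕ → ZMod 2, PRAC.Generates g a → a ≠ 0 →
        PRAC.HasLeastPeriod a ((n₁ + 1) * (n₂ + 1))) ∧
      ∃ C : Set (PRAC.BinArray (n₁ + 1) (n₂ + 1)),
        PRAC.IsPRAC (n₁ + 1) (n₂ + 1) n₁ n₂ C ∧
        (∀ A ∈ C, ∃ a : ℕ → ZMod 2, PRAC.Generates g a ∧ a ≠ 0 ∧ PRAC.IsFolding a A) ∧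
        (∀ a : ℕ → ZMod 2, PRAC.Generates g a → a ≠ 0 →
          ∃ A ∈ C, ∃ (s : ZMod (n₁ + 1)) (t : ZMod (n₂ + 1)),
            PRAC.IsFolding a (PRAC.shift A s t)) := by
  have : Fact (n₁ + 1).Prime := ⟨hp₁⟩
  have : Fact (n₂ + 1).Prime := ⟨hp₂⟩
  have hco : (n₁ + 1).Coprime (n₂ + 1) := (Nat.coprime_primes hp₁ hp₂).2 hne
  have hgen {a : ℕ → ZMod 2} := PRAC.generates_cyclotomic_iff hne hodd₁ hodd₂ (a := a)
  refine ⟨⟨PRAC.hasExponent_allOnes hodd₁, PRAC.hasUniformExponent_allOnes hodd₁⟩,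
    ⟨PRAC.hasExponent_allOnes hodd₂, PRAC.hasUniformExponent_allOnes hodd₂⟩,
    Polynomial.cyclotomic ((n₁ + 1) * (n₂ + 1)) (ZMod 2),
    PRAC.isVee_cyclotomic hne hodd₁ hodd₂, fun a ha h0 => ?_,
    PRAC.zeroSumCode (n₁ + 1) (n₂ + 1), PRAC.isPRAC_zeroSumCode hne hodd₁ hodd₂,
    fun A hA => ⟨PRAC.unfolding A, hgen.2 ⟨A, hA.1, rfl⟩, fun h => hA.2.1 ?_,
      PRAC.isFolding_unfolding hco A⟩, fun a ha h0 => ?_⟩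
  · obtain ⟨A, hA, rfl⟩ := hgen.1 ha
    exact PRAC.hasLeastPeriod_unfolding hne hodd₁ hodd₂ hA fun hA0 => h0 (hA0 ▸ rfl)
  · exact PRAC.unfolding_injective hco h
  · obtain ⟨A, hA, rfl⟩ := hgen.1 ha
    obtain ⟨D, hD, s, t, rfl⟩ := PRAC.exists_mem_zeroSumCode hA fun hA0 => h0 (hA0 ▸ rfl)
    exact ⟨D, hD, s, t, PRAC.isFolding_unfolding hco _⟩
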